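/- **Conventions.** A *theory* $T$ is a category with objects $0,1,2,\dots$ in which each $n$ is the product of $n$ copies of $1$, with chosen limiting projections $pr_1,\dots,pr_n:n\to 1$. Put $T(n)=\mathrm{Mor}_T(n,1)$ (the words of arity $n$), $\mathbf 1=pr_1\in T(1)$; for $w\in T(m)$ and $f:\{1,\dots,m\}\to\{1,\dots,n\}$ put $w_f=w\circ(pr_{f1},\dots,pr_{fm})\in T(n)$; and for $w\in T(k)$, $w_i\in T(n_i)$ let $\gamma(w,w_1,\dots,w_k)\in T(n_1+\dots+n_k)$ be the composite of $w$ with the tuple of the $w_i$, where $w_i$ is applied to the $i$-th block of variables. For a category $X$, functors $X^n\to X$ have the analogous operations $\gamma$, $G_f(x_1,\dots,x_n)=G(x_{f1},\dots,x_{fm})$, and unit $1_X$. The operations of every theory satisfy $\gamma(w,\gamma(v_1,u_{11},\dots),\dots,\gamma(v_k,u_{k1},\dots))=\gamma(\gamma(w,v_1,\dots,v_k),u_{11},u_{12},\dots)$; $\gamma(w,\mathbf 1,\dots,\mathbf 1)=w=\gamma(\mathbf 1,w)$; $\gamma(w_f,w_1,\dots,w_l)=\gamma(w,w_{f1},\dots,w_{fk})_{\bar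 f}$ ($\bar f$ moves entire blocks according to $f$); $\gamma(w,(w_1)_{g_1},\dots,(w_k)_{g_k})=\gamma(w,w_1,\dots,w_k)_{g_1+\dots+g_k}$; $(w_f)_g=w_{g\circ f}$; $w_{\mathrm{id}}=w$. A *pseudo $T$-algebra* is a category $X$ with functors $\Phi(w):X^n\to X$ for all $n\ge 0$, $w\in T(n)$, and natural isomorphisms $c_{w,w_1,\dots,w_k}:\Phi(\gamma(w,w_1,\dots,w_k))\Rightarrow\gamma(\Phi(w),\Phi(w_1),\dots,\Phi(w_k))$, $I:\Phi(\mathbf 1)\Rightarrow 1_X$, $s_{w,f}:\Phi(w_f)\Rightarrow\Phi(w)_f$, satisfying one coherence diagram for each relation listed above: the two composites of coherence isomorphisms determined by the two sides of the relation agree (for $w_{\mathrm{id}}=w$: $s_{w,\mathrm{id}}$ is the identity). A *morphism* $(X,\Phi)\to(Y,\Psi)$ is a functor $H:X\to Y$ with natural isomorphisms $\rho^H_w:H\circ\Phi(w)\Rightarrow\Psi(w)\circ(H,\dots,H)$, for all words $w$, that commute with the coherence isomorphisms $c$, $I$, $s$. A *2-cell* $\alpha:G\Rightarrow H$ is a natural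 transformation with $\Psi(w)(\alpha_{x_1},\dots,\alpha_{x_n})\circ\rho^G_w=\rho^H_w\circ\alpha_{\Phi(w)(x_1,\dots,x_n)}$ for all $w$ and $x_1,\dots,x_n$. With $\rho^{H\circ G}_w=(\rho^H_w*(G,\dots,G))\circ(H*\rho^G_w)$, the small pseudo $T$-algebras form a 2-category $\mathcal C_T$, with forgetful 2-functor $U:\mathcal C_T\to Cat$. For a small category $\mathcal J$, a pseudo functor $F$ from $\mathcal J$ to a 2-category $\mathcal C$, and $V\in\mathcal C$, let $PseudoCone(V,F)$ be the category of pseudo natural transformations $\Delta_V\Rightarrow F$ from the constant 2-functor, with modifications as morphisms. Such an $\eta$ consists of 1-cells $\eta_j:V\to Fj$ and, coherently, invertible 2-cells $\tau^\eta_f:Ff\circ\eta_i\Rightarrow\eta_j$ for $f:i\to j$. A *pseudo limit* of $F$ is an object $L$ with a pseudo cone $\pi:\Delta_L\Rightarrow F$ such that, for every object $V$, the functor $Mor_{\mathcal C}(V,L)\to PseudoCone(V,F)$, $b\mapsto\pi\circ b$, of composition with $\pi$ is an isomorphism of categories. **Theorem.** Let $T$ be a theory, $\mathcal J$ a small 1-category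 and $F:\mathcal J\to\mathcal C_T$ a pseudo functor into the 2-category of small pseudo $T$-algebras. Then $F$ has a pseudo limit. More precisely, let $L=PseudoCone(\mathbf{*},U\circ F)$, where $\mathbf *$ is the category with one object $*$ and one morphism. Then there are a pseudo $T$-algebra structure on $L$ and a pseudo cone $\pi:\Delta_L\Rightarrow F$ in $\mathcal C_T$ such that: 1. The structure on $L$ is componentwise. For $w\in T(n)$, $\eta^1,\dots,\eta^n\in L$, $j\in\mathcal J$ and $f:i\to j$ in $\mathcal J$, $$\Phi(w)(\eta^1,\dots,\eta^n)_j(*)=\Phi_{Fj}(w)(\eta^1_j(*),\dots,\eta^n_j(*)),$$ $$\tau^{\Phi(w)(\eta^1,\dots,\eta^n)}_f(*)=\Phi_{Fj}(w)\bigl(\tau^{\eta^1}_f(*),\dots,\tau^{\eta^n}_f(*)\bigr)\circ\rho^{Ff}_w\bigl(\eta^1_i(*),\dots,\eta^n_i(*)\bigr);$$ likewise $\Phi(w)(\Theta^1,\dots,\Theta^n)_j(*)=\Phi_{Fj}(w)(\Theta^1_j(*),\dots,\Theta^n_j(*))$ for morphisms $\Theta^l$ of $L$; and the components at $j$ of the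 coherence isomorphisms $c$, $I$, $s$ of $L$ are those of $Fj$. 2. $\pi$ is evaluation: $\pi_j(\eta)=\eta_j(*)$ and $\pi_j(\Theta)=\Theta_j(*)$, all $\rho^{\pi_j}_w$ are identities, and $\tau^\pi_f$ has the component $\tau^\eta_f(*)$ at $\eta\in L$. 3. For every small pseudo $T$-algebra $V$, composition with $\pi$ is an isomorphism of categories $Mor_{\mathcal C_T}(V,L)\to PseudoCone(V,F)$. -/

import Mathlib

open CategoryTheory Bicategory
open scoped Pseudofunctor.StrongTrans

universe w v u

/-- The inclusion of `{1, …, n i}` as the `i`-th block of `{1, …, n 1 + ⋯ + n k}`. -/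
def blockIncl {k : ℕ} {n : Fin k → ℕ} (i : Fin k) (j : Fin (n i)) : Fin (∑ i, n i) :=
  finSigmaFinEquiv ⟨i, j⟩

/-- The map that moves entire blocks according to `f`: `j` in block `i` goes to `j` in block `f i`. -/
def blockMap {k l : ℕ} (n : Fin l → ℕ) (f : Fin k → Fin l) (p : Fin (∑ i, n (f i))) :
    Fin (∑ i, n i) :=
  blockIncl (f (finSigmaFinEquiv.symm p).1) (finSigmaFinEquiv.symm p).2

/-- The map `g₁ + ⋯ + g_k`. -/
def sumMap {k : ℕ} {n n' : Fin k → ℕ} (g : ∀ i, Fin (n i) → Fin (n' i)) (p : Fin (∑ i, n i)) :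
    Fin (∑ i, n' i) :=
  blockIncl (finSigmaFinEquiv.symm p).1 (g _ (finSigmaFinEquiv.symm p).2)

theorem blockMap_blockIncl {k l : ℕ} (n : Fin l → ℕ) (f : Fin k → Fin l) (i : Fin k)
    (j : Fin (n (f i))) :
    blockMap n f (blockIncl (n := fun i => n (f i)) i j) = blockIncl (f i) j := by
  simp only [blockMap, blockIncl]
  rw [finSigmaFinEquiv.symm_apply_apply]

theorem sumMap_blockIncl {k : ℕ} {n n' : Fin k → ℕ} (g : ∀ i, Fin (n i) → Fin (n' i)) (i : Fin k)
    (j : Fin (n i)) : sumMap g (blockIncl i j) = blockIncl i (g i j) := by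
  simp only [sumMap, blockIncl]
  rw [finSigmaFinEquiv.symm_apply_apply]

theorem sum_blocks {k : ℕ} {n : Fin k → ℕ} (m : Fin (∑ i, n i) → ℕ) :
    ∑ i, ∑ j, m (blockIncl i j) = ∑ p, m p := by
  rw [← Equiv.sum_comp finSigmaFinEquiv, Fintype.sum_sigma]
  rfl

theorem blockIncl_val {k : ℕ} {n : Fin k → ℕ} (i : Fin k) (j : Fin (n i)) (N : ℕ → ℕ)
    (hN : ∀ i, N i.val = n i) :
    (blockIncl i j : ℕ) = ∑ t ∈ Finset.range i, N t + j := by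
  simp only [blockIncl, finSigmaFinEquiv_apply, Finset.sum_range]
  congr 1
  exact Finset.sum_congr rfl fun t _ => (hN (Fin.castLE i.2.le t)).symm

theorem blockIncl_assoc {k : ℕ} {n : Fin k → ℕ} (m : Fin (∑ i, n i) → ℕ) (i : Fin k)
    (j : Fin (n i)) (l : Fin (m (blockIncl i j))) :
    Fin.cast (sum_blocks m)
      (blockIncl (n := fun i => ∑ j, m (blockIncl i j)) i
        (blockIncl (n := fun j => m (blockIncl i j)) j l)) = blockIncl (blockIncl i j) l := by
  let N : ℕ → ℕ := fun t => if h : t < k then n ⟨t, h⟩ else 0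
  have hN : ∀ i : Fin k, N i.val = n i := fun i => by simp [N]
  let M : ℕ → ℕ := fun t => if h : t < ∑ i, n i then m ⟨t, h⟩ else 0
  have hM : ∀ p, M p.val = m p := fun p => by simp [M]
  have hM' : ∀ (i : Fin k) (j : Fin (n i)), M (∑ t ∈ Finset.range i, N t + j) = m (blockIncl i j) :=
    fun i j => by rw [← blockIncl_val i j N hN, hM]
  ext
  rw [Fin.val_cast, blockIncl_val _ _ M hM,
    blockIncl_val i _ (fun a => ∑ b ∈ Finset.range (N a), M (∑ t ∈ Finset.range a, N t + b)),
    blockIncl_val j l (fun b => M (∑ t ∈ Finset.range i, N t + b)) (hM' i), blockIncl_val i j N hN,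
    Finset.sum_range_add, ← add_assoc]
  · congr 2
    generalize (i : ℕ) = a
    induction a with
    | zero => simp
    | succ a ih => rw [Finset.sum_range_succ, ih, Finset.sum_range_succ _ a, Finset.sum_range_add]
  · intro i
    rw [hN, Finset.sum_range]
    exact Finset.sum_congr rfl fun j _ => hM' i j

theorem sum_one (n : ℕ) : ∑ _i : Fin n, 1 = n := by simp

theorem sum_single (n : ℕ) : ∑ _i : Fin 1, n = n := by simp

theorem cast_blockIncl_ones {n : ℕ} (i : Fin n) (j : Fin 1) :
    Fin.cast (sum_one n) (blockIncl (n := fun _ => 1) i j) = i := by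
  ext
  rw [Fin.val_cast, blockIncl_val _ _ (fun _ => 1) (fun _ => rfl)]
  simp

theorem cast_blockIncl_single {n : ℕ} (j : Fin n) :
    Fin.cast (sum_single n) (blockIncl (n := fun _ : Fin 1 => n) 0 j) = j := by
  ext
  rw [Fin.val_cast, blockIncl_val _ _ (fun _ => n) (fun _ => rfl)]
  simp

/-- A theory: a category with objects `0, 1, 2, …` such that each `n` is the product of `n` copies
of `1`, with a chosen limiting cone. -/
structure LawvereTheory where
  C : Type
  [cat : Category.{v} C]
  obj : ℕ ≃ C
  proj (n : ℕ) (i : Fin n) : obj n ⟶ obj 1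
  isLimit (n : ℕ) : Limits.IsLimit (Limits.Fan.mk (obj n) (proj n))

namespace LawvereTheory

attribute [instance] LawvereTheory.cat

variable {T : LawvereTheory.{v}}

variable (T) in
/-- `T(n)`, the set of words of arity `n`. -/
abbrev Word (n : ℕ) : Type v := T.obj n ⟶ T.obj 1

/-- The morphism into `n` with the given components. -/
def tuple {m n : ℕ} (w : Fin n → T.Word m) : T.obj m ⟶ T.obj n :=
  Limits.Fan.IsLimit.lift (T.isLimit n) w

/-- The substituted word `w_f`. -/
def subst {m n : ℕ} (f : Fin m → Fin n) (w : T.Word m) : T.Word n :=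
  tuple (fun i => T.proj n (f i)) ≫ w

/-- The composition `γ(w, w₁, …, w_k) = w ∘ (w₁, …, w_k)`. -/
def gamma {k : ℕ} {n : Fin k → ℕ} (w : T.Word k) (ws : ∀ i, T.Word (n i)) : T.Word (∑ i, n i) :=
  tuple (fun i => subst (blockIncl i) (ws i)) ≫ w

variable (T) in
/-- The identity word `1`, which is the projection `1 ⟶ 1`. -/
def one : T.Word 1 := T.proj 1 0

@[simp]
theorem tuple_proj {m n : ℕ} (w : Fin n → T.Word m) (i : Fin n) : tuple w ≫ T.proj n i = w i :=
  Limits.Fan.IsLimit.fac (T.isLimit n) w i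

@[simp]
theorem tuple_proj_assoc {m n : ℕ} (w : Fin n → T.Word m) (i : Fin n) {Z : T.C}
    (h : T.obj 1 ⟶ Z) : tuple w ≫ T.proj n i ≫ h = w i ≫ h := by
  rw [← Category.assoc, tuple_proj]

theorem hom_ext {m n : ℕ} {f g : T.obj m ⟶ T.obj n}
    (h : ∀ i, f ≫ T.proj n i = g ≫ T.proj n i) : f = g :=
  Limits.Fan.IsLimit.hom_ext (T.isLimit n) _ _ h

/-- Precomposing a tuple by the morphism of projections. -/
theorem comp_tuple {l m n : ℕ} (a : T.obj l ⟶ T.obj m) (w : Fin n → T.Word m) :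
    a ≫ tuple w = tuple fun i => a ≫ w i :=
  hom_ext fun i => by simp

theorem subst_subst {l m n : ℕ} (f : Fin l → Fin m) (g : Fin m → Fin n) (w : T.Word l) :
    subst g (subst f w) = subst (g ∘ f) w := by
  simp [subst, comp_tuple, ← Category.assoc]

theorem subst_id {n : ℕ} (w : T.Word n) : subst id w = w := by
  have : tuple (fun i => T.proj n (id i)) = 𝟙 (T.obj n) := hom_ext fun i => by simp
  rw [subst, this, Category.id_comp]

theorem subst_gamma {k n' : ℕ} {n : Fin k → ℕ} (f : Fin (∑ i, n i) → Fin n') (w : T.Word k)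
    (ws : ∀ i, T.Word (n i)) :
    subst f (gamma w ws) = tuple (fun i => subst (f ∘ blockIncl i) (ws i)) ≫ w := by
  rw [subst, gamma, ← Category.assoc, comp_tuple]
  simp only [← subst_subst]
  rfl

theorem gamma_subst_left {k l : ℕ} (f : Fin k → Fin l) {n : Fin l → ℕ} (w : T.Word k)
    (ws : ∀ i, T.Word (n i)) :
    subst (blockMap n f) (gamma w fun i => ws (f i)) = gamma (subst f w) ws := by
  rw [subst_gamma, gamma, subst, ← Category.assoc, comp_tuple]
  congr 2
  funext i
  rw [tuple_proj]
  congr 1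
  funext j
  exact blockMap_blockIncl n f i j

theorem gamma_subst_right {k : ℕ} {n n' : Fin k → ℕ} (g : ∀ i, Fin (n i) → Fin (n' i))
    (w : T.Word k) (ws : ∀ i, T.Word (n i)) :
    subst (sumMap g) (gamma w ws) = gamma w fun i => subst (g i) (ws i) := by
  rw [subst_gamma, gamma]
  congr 2
  funext i
  rw [subst_subst]
  congr 1
  funext j
  exact sumMap_blockIncl g i j

theorem gamma_assoc {k : ℕ} {n : Fin k → ℕ} {m : Fin (∑ i, n i) → ℕ} (w : T.Word k)
    (v : ∀ i, T.Word (n i)) (u : ∀ p, T.Word (m p)) :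
    subst (Fin.cast (sum_blocks m)) (gamma w fun i => gamma (v i) fun j => u (blockIncl i j)) =
      gamma (gamma w v) u := by
  rw [subst_gamma, gamma, gamma, ← Category.assoc, comp_tuple]
  congr 2
  funext i
  rw [subst_gamma, subst, ← Category.assoc, comp_tuple]
  congr 2
  funext j
  rw [tuple_proj]
  congr 1
  funext l
  exact blockIncl_assoc m i j l

theorem gamma_one_right {n : ℕ} (w : T.Word n) :
    subst (Fin.cast (sum_one n)) (gamma w fun _ : Fin n => T.one) = w := by
  have : tuple (fun i => subst (Fin.cast (sum_one n) ∘ blockIncl i) T.one) = 𝟙 (T.obj n) :=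
    hom_ext fun i => by simp [subst, one, cast_blockIncl_ones]
  rw [subst_gamma, this, Category.id_comp]

theorem gamma_one_left {n : ℕ} (w : T.Word n) :
    subst (Fin.cast (sum_single n)) (gamma T.one fun _ : Fin 1 => w) = w := by
  rw [subst_gamma, one, tuple_proj]
  have : Fin.cast (sum_single n) ∘ blockIncl (n := fun _ : Fin 1 => n) 0 = id :=
    funext fun j => cast_blockIncl_single j
  rw [this, subst_id]

end LawvereTheory
section Words

variable {X : Type u} [Category.{v} X] {Y : Type u} [Category.{v} Y]

/-- The functor `Hⁿ = (H, …, H) : Xⁿ ⥤ Yⁿ`. -/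
abbrev powerF (H : X ⥤ Y) (n : ℕ) : (Fin n → X) ⥤ (Fin n → Y) where
  obj z i := H.obj (z i)
  map h i := H.map (h i)

variable (X) in
/-- The identity functor of `X`, as an object of `End(X)(1)`: the functor `X¹ ⥤ X`. -/
abbrev unaryF : (Fin 1 → X) ⥤ X where
  obj z := z 0
  map h := h 0

/-- The substituted functor `G_f`, `(x₁, …, x_n) ↦ G (x_{f 1}, …, x_{f m})`. -/
abbrev substF {m n : ℕ} (f : Fin m → Fin n) (G : (Fin m → X) ⥤ X) : (Fin n → X) ⥤ X where
  obj z := G.obj fun i => z (f i)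
  map h := G.map fun i => h (f i)
  map_id z := G.map_id fun i => z (f i)
  map_comp h h' := G.map_comp (fun i => h (f i)) fun i => h' (f i)

/-- The composite functor `γ(G, G₁, …, G_k) = G ∘ (G₁, …, G_k)`, where `G_i` is applied to the
`i`-th block of variables. -/
abbrev gammaF {k : ℕ} {n : Fin k → ℕ} (G : (Fin k → X) ⥤ X) (Gs : ∀ i, (Fin (n i) → X) ⥤ X) :
    (Fin (∑ i, n i) → X) ⥤ X where
  obj z := G.obj fun i => (Gs i).obj fun j => z (blockIncl i j)
  map h := G.map fun i => (Gs i).map fun j => h (blockIncl i j)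
  map_id z := by
    rw [← G.map_id]
    exact congrArg G.map (funext fun i => (Gs i).map_id _)
  map_comp h h' := by
    rw [← G.map_comp]
    exact congrArg G.map (funext fun i => (Gs i).map_comp _ _)

theorem gammaF_assoc {k : ℕ} {n : Fin k → ℕ} {m : Fin (∑ i, n i) → ℕ} (G : (Fin k → X) ⥤ X)
    (Gs : ∀ i, (Fin (n i) → X) ⥤ X) (Hs : ∀ p, (Fin (m p) → X) ⥤ X) (z : Fin (∑ p, m p) → X) :
    (gammaF G Gs).obj (fun p => (Hs p).obj fun l => z (blockIncl p l)) =
      G.obj fun i => (gammaF (Gs i) fun j => Hs (blockIncl i j)).obj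
        fun q => z (Fin.cast (sum_blocks m) (blockIncl i q)) := by
  refine congrArg G.obj (funext fun i => congrArg (Gs i).obj (funext fun j =>
    congrArg (Hs (blockIncl i j)).obj (funext fun l => ?_)))
  exact congrArg z (blockIncl_assoc m i j l).symm

theorem gammaF_blockMap {k l : ℕ} (f : Fin k → Fin l) {n : Fin l → ℕ} (G : (Fin k → X) ⥤ X)
    (Gs : ∀ i, (Fin (n i) → X) ⥤ X) (z : Fin (∑ i, n i) → X) :
    (substF f G).obj (fun i => (Gs i).obj fun j => z (blockIncl i j)) =
      (gammaF G fun i => Gs (f i)).obj fun p => z (blockMap n f p) := by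
  refine congrArg G.obj (funext fun i => congrArg (Gs (f i)).obj (funext fun j => ?_))
  exact congrArg z (blockMap_blockIncl n f i j).symm

theorem gammaF_sumMap {k : ℕ} {n n' : Fin k → ℕ} (g : ∀ i, Fin (n i) → Fin (n' i))
    (G : (Fin k → X) ⥤ X) (Gs : ∀ i, (Fin (n i) → X) ⥤ X) (z : Fin (∑ i, n' i) → X) :
    (G.obj fun i => (substF (g i) (Gs i)).obj fun j => z (blockIncl i j)) =
      (gammaF G Gs).obj fun p => z (sumMap g p) := by
  refine congrArg G.obj (funext fun i => congrArg (Gs i).obj (funext fun j => ?_))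
  exact congrArg z (sumMap_blockIncl g i j).symm

theorem obj_congr {T : LawvereTheory.{w}} (Φ : ∀ {n : ℕ}, T.Word n → (Fin n → X) ⥤ X) {m n : ℕ}
    (h : m = n) {p : T.Word m} {q : T.Word n} (e : LawvereTheory.subst (Fin.cast h) p = q)
    (z : Fin n → X) : ((Φ p).obj fun i => z (Fin.cast h i)) = (Φ q).obj z := by
  subst h
  rw [← e, show Fin.cast (rfl : m = m) = id from rfl, LawvereTheory.subst_id]
  rfl

end Words

section Algebras

open LawvereTheory

/-- The structure of a pseudo `T`-algebra on the category `X`: structure maps `Φ`, coherence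
isomorphisms `c`, `I`, `s` for composition, identity and substitution, and the coherence diagrams,
each evaluated on an arbitrary tuple `z` of objects. The morphisms `eqToHom _` are the identities
that stand for the equality signs in the diagrams. -/
structure PseudoAlgebra (T : LawvereTheory.{w}) (X : Type u) [Category.{v} X] where
  /-- the structure maps `Φ_n : T(n) → Functors(Xⁿ, X)` -/
  Φ {n : ℕ} (w : T.Word n) : (Fin n → X) ⥤ X
  /-- the composition is preserved up to `c_{w, w₁, …, w_k}` -/
  c {k : ℕ} {n : Fin k → ℕ} (w : T.Word k) (ws : ∀ i, T.Word (n i)) :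
    Φ (gamma w ws) ≅ gammaF (Φ w) fun i => Φ (ws i)
  /-- the identity is preserved up to `I` -/
  I : Φ T.one ≅ unaryF X
  /-- the substitution is preserved up to `s_{w, f}` -/
  s {m n : ℕ} (f : Fin m → Fin n) (w : T.Word m) : Φ (subst f w) ≅ substF f (Φ w)
  /-- `c` is associative -/
  c_assoc {k : ℕ} {n : Fin k → ℕ} {m : Fin (∑ i, n i) → ℕ} (w : T.Word k)
      (v : ∀ i, T.Word (n i)) (u : ∀ p, T.Word (m p)) (z : Fin (∑ p, m p) → X) :
    (c w fun i => gamma (v i) fun j => u (blockIncl i j)).hom.app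
          (fun q => z (Fin.cast (sum_blocks m) q)) ≫
        (Φ w).map (fun i => (c (v i) fun j => u (blockIncl i j)).hom.app
          fun q => z (Fin.cast (sum_blocks m) (blockIncl i q))) =
      eqToHom (obj_congr Φ _ (gamma_assoc w v u) z) ≫ (c (gamma w v) u).hom.app z ≫
        (c w v).hom.app (fun p => (Φ (u p)).obj fun l => z (blockIncl p l)) ≫
        eqToHom (gammaF_assoc _ _ _ z)
  /-- `c` and `I` are compatible with `γ(w, 1, …, 1) = w` -/
  c_one_right {n : ℕ} (w : T.Word n) (z : Fin n → X) :
    (c w fun _ : Fin n => T.one).hom.app (fun q => z (Fin.cast (sum_one n) q)) ≫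
        (Φ w).map (fun i => I.hom.app fun j => z (Fin.cast (sum_one n) (blockIncl i j))) =
      eqToHom (obj_congr Φ _ (gamma_one_right w) z) ≫ eqToHom (by simp [cast_blockIncl_ones])
  /-- `c` and `I` are compatible with `γ(1, w) = w` -/
  c_one_left {n : ℕ} (w : T.Word n) (z : Fin n → X) :
    (c T.one fun _ : Fin 1 => w).hom.app (fun q => z (Fin.cast (sum_single n) q)) ≫
        I.hom.app (fun i => (Φ w).obj fun j => z (Fin.cast (sum_single n) (blockIncl i j))) =
      eqToHom (obj_congr Φ _ (gamma_one_left w) z) ≫ eqToHom (by simp [cast_blockIncl_single])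
  /-- `c` and `s` are compatible with `γ(w_f, w₁, …, w_l) = γ(w, w_{f 1}, …, w_{f k})_{f̄}` -/
  c_subst_left {k l : ℕ} (f : Fin k → Fin l) {n : Fin l → ℕ} (w : T.Word k)
      (ws : ∀ i, T.Word (n i)) (z : Fin (∑ i, n i) → X) :
    (s (blockMap n f) (gamma w fun i => ws (f i))).hom.app z ≫
        (c w fun i => ws (f i)).hom.app (fun p => z (blockMap n f p)) =
      eqToHom (by rw [gamma_subst_left]) ≫ (c (subst f w) ws).hom.app z ≫
        (s f w).hom.app (fun i => (Φ (ws i)).obj fun j => z (blockIncl i j)) ≫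
        eqToHom (gammaF_blockMap f _ _ z)
  /-- `c` and `s` are compatible with
  `γ(w, (w₁)_{g₁}, …, (w_k)_{g_k}) = γ(w, w₁, …, w_k)_{g₁ + ⋯ + g_k}` -/
  c_subst_right {k : ℕ} {n n' : Fin k → ℕ} (g : ∀ i, Fin (n i) → Fin (n' i)) (w : T.Word k)
      (ws : ∀ i, T.Word (n i)) (z : Fin (∑ i, n' i) → X) :
    (s (sumMap g) (gamma w ws)).hom.app z ≫ (c w ws).hom.app (fun p => z (sumMap g p)) =
      eqToHom (by rw [gamma_subst_right]) ≫ (c w fun i => subst (g i) (ws i)).hom.app z ≫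
        (Φ w).map (fun i => (s (g i) (ws i)).hom.app fun j => z (blockIncl i j)) ≫
        eqToHom (gammaF_sumMap g _ _ z)
  /-- `s` is compatible with `(w_f)_g = w_{g ∘ f}` -/
  s_comp {l m n : ℕ} (f : Fin l → Fin m) (g : Fin m → Fin n) (w : T.Word l) (z : Fin n → X) :
    (s g (subst f w)).hom.app z ≫ (s f w).hom.app (fun i => z (g i)) =
      eqToHom (by rw [subst_subst]) ≫ (s (g ∘ f) w).hom.app z
  /-- `s_{w, id}` is the identity -/
  s_id {n : ℕ} (w : T.Word n) (z : Fin n → X) :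
    (s id w).hom.app z = eqToHom (by rw [subst_id]; rfl)

namespace PseudoAlgebra

variable {T : LawvereTheory.{w}} {X : Type u} [Category.{v} X] {Y : Type u} [Category.{v} Y]
  {Z : Type u} [Category.{v} Z] {A : PseudoAlgebra T X} {B : PseudoAlgebra T Y}
  {C : PseudoAlgebra T Z}

/-- A (pseudo) morphism of pseudo `T`-algebras: a functor `H : X ⥤ Y` with natural isomorphisms
`ρ_w : H ∘ Φ(w) ⇒ Ψ(w) ∘ (H, …, H)` compatible with `c`, `I` and `s`. -/
structure Hom (A : PseudoAlgebra T X) (B : PseudoAlgebra T Y) where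
  functor : X ⥤ Y
  ρ {n : ℕ} (w : T.Word n) : A.Φ w ⋙ functor ≅ powerF functor n ⋙ B.Φ w
  ρ_gamma {k : ℕ} {n : Fin k → ℕ} (w : T.Word k) (ws : ∀ i, T.Word (n i))
      (z : Fin (∑ i, n i) → X) :
    (ρ (gamma w ws)).hom.app z ≫ (B.c w ws).hom.app (fun p => functor.obj (z p)) =
      functor.map ((A.c w ws).hom.app z) ≫
        (ρ w).hom.app (fun i => (A.Φ (ws i)).obj fun j => z (blockIncl i j)) ≫
        (B.Φ w).map (fun i => (ρ (ws i)).hom.app fun j => z (blockIncl i j))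
  ρ_one (z : Fin 1 → X) :
    (ρ T.one).hom.app z ≫ B.I.hom.app (fun i => functor.obj (z i)) = functor.map (A.I.hom.app z)
  ρ_subst {m n : ℕ} (f : Fin m → Fin n) (w : T.Word m) (z : Fin n → X) :
    (ρ (subst f w)).hom.app z ≫ (B.s f w).hom.app (fun i => functor.obj (z i)) =
      functor.map ((A.s f w).hom.app z) ≫ (ρ w).hom.app fun i => z (f i)

namespace Hom

/-- A 2-cell `G ⇒ H` of pseudo `T`-algebras: a natural transformation compatible with `ρ`. -/
@[ext]
structure TwoCell (G H : Hom A B) where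
  nat : G.functor ⟶ H.functor
  comm {n : ℕ} (w : T.Word n) (z : Fin n → X) :
    (G.ρ w).hom.app z ≫ (B.Φ w).map (fun i => nat.app (z i)) =
      nat.app ((A.Φ w).obj z) ≫ (H.ρ w).hom.app z

theorem TwoCell.comm_assoc {G H : Hom A B} (α : TwoCell G H) {n : ℕ} (w : T.Word n)
    (z : Fin n → X) {y : Y} (h : (B.Φ w).obj (fun i => H.functor.obj (z i)) ⟶ y) :
    (G.ρ w).hom.app z ≫ (B.Φ w).map (fun i => α.nat.app (z i)) ≫ h =
      α.nat.app ((A.Φ w).obj z) ≫ (H.ρ w).hom.app z ≫ h := by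
  rw [← Category.assoc, α.comm, Category.assoc]

theorem map_tuple_id {n : ℕ} (G : (Fin n → X) ⥤ X) (z : Fin n → X) :
    G.map (fun i => 𝟙 (z i)) = 𝟙 (G.obj z) :=
  G.map_id z

theorem map_tuple_comp {n : ℕ} (G : (Fin n → X) ⥤ X) {z z' z'' : Fin n → X}
    (h : ∀ i, z i ⟶ z' i) (h' : ∀ i, z' i ⟶ z'' i) :
    G.map (fun i => h i ≫ h' i) = G.map (X := z) (Y := z') h ≫ G.map (X := z') (Y := z'') h' :=
  G.map_comp (X := z) (Y := z') (Z := z'') h h'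

/-- The naturality of `ρ`. -/
theorem ρ_naturality (H : Hom A B) {n : ℕ} (w : T.Word n) {z z' : Fin n → X}
    (h : ∀ i, z i ⟶ z' i) :
    H.functor.map ((A.Φ w).map (X := z) (Y := z') h) ≫ (H.ρ w).hom.app z' =
      (H.ρ w).hom.app z ≫ (B.Φ w).map (fun i => H.functor.map (h i)) :=
  (H.ρ w).hom.naturality (X := z) (Y := z') h

theorem ρ_naturality_assoc (H : Hom A B) {n : ℕ} (w : T.Word n) {z z' : Fin n → X}
    (h : ∀ i, z i ⟶ z' i) {y : Y} (e : (B.Φ w).obj (fun i => H.functor.obj (z' i)) ⟶ y) :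
    H.functor.map ((A.Φ w).map (X := z) (Y := z') h) ≫ (H.ρ w).hom.app z' ≫ e =
      (H.ρ w).hom.app z ≫ (B.Φ w).map (fun i => H.functor.map (h i)) ≫ e := by
  rw [← Category.assoc, ρ_naturality, Category.assoc]

@[simps id_nat comp_nat]
instance : Category (Hom A B) where
  Hom := TwoCell
  id H :=
    { nat := 𝟙 H.functor
      comm := fun w z => by
        simp only [NatTrans.id_app]
        rw [map_tuple_id]
        simp }
  comp α β :=
    { nat := α.nat ≫ β.nat
      comm := fun w z => by
        simp only [NatTrans.comp_app]
        rw [map_tuple_comp, α.comm_assoc, β.comm, Category.assoc] }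

@[ext]
theorem hom_ext₂ {G H : Hom A B} {α β : G ⟶ H} (h : α.nat = β.nat) : α = β :=
  TwoCell.ext h

variable (A) in
/-- The identity morphism. -/
abbrev id : Hom A A where
  functor := 𝟭 X
  ρ w := Iso.refl (A.Φ w)
  ρ_gamma w ws z := by
    simp only [Iso.refl_hom, NatTrans.id_app, Functor.id_map]
    erw [map_tuple_id]
    simp
  ρ_one z := by simp
  ρ_subst f w z := by simp

/-- The composite `H ∘ G`, with coherence isomorphisms `ρ^{H ∘ G} = (ρ^H * G) ⊙ (H * ρ^G)`. -/
abbrev comp (G : Hom A B) (H : Hom B C) : Hom A C where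
  functor := G.functor ⋙ H.functor
  ρ w := NatIso.ofComponents
    (fun z => H.functor.mapIso ((G.ρ w).app z) ≪≫ (H.ρ w).app fun i => G.functor.obj (z i))
    (fun {z z'} h => by
      have := G.ρ_naturality w h
      dsimp at this ⊢
      rw [← Functor.map_comp_assoc, this, Functor.map_comp_assoc, Category.assoc, H.ρ_naturality])
  ρ_gamma w ws z := by
    dsimp
    rw [Category.assoc, H.ρ_gamma, map_tuple_comp, ← Functor.map_comp_assoc, G.ρ_gamma,
      Functor.map_comp_assoc, Functor.map_comp_assoc]
    erw [H.ρ_naturality_assoc w fun i => (G.ρ (ws i)).hom.app fun j => z (blockIncl i j)]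
    simp only [Category.assoc]
    rfl
  ρ_one z := by 
    dsimp
    rw [Category.assoc, H.ρ_one, ← Functor.map_comp, G.ρ_one]
  ρ_subst f w z := by
    dsimp
    rw [Category.assoc, H.ρ_subst, ← Functor.map_comp_assoc, G.ρ_subst, Functor.map_comp_assoc]

/-- Horizontal composition of a 2-cell with the identity of `G`. -/
@[simps]
def whiskerLeft (G : Hom A B) {H K : Hom B C} (α : H ⟶ K) : G.comp H ⟶ G.comp K where
  nat := Functor.whiskerLeft G.functor α.nat
  comm w z := by
    dsimp
    rw [Category.assoc, α.comm, α.nat.naturality_assoc]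
    

/-- Horizontal composition of a 2-cell with the identity of `K`. -/
@[simps]
def whiskerRight {G H : Hom A B} (α : G ⟶ H) (K : Hom B C) : G.comp K ⟶ H.comp K where
  nat := Functor.whiskerRight α.nat K.functor
  comm w z := by
    dsimp
    rw [Category.assoc, ← K.ρ_naturality, ← Functor.map_comp_assoc, α.comm, Functor.map_comp_assoc]

theorem comp_assoc {W : Type u} [Category.{v} W] {D : PseudoAlgebra T W} (F : Hom A B)
    (G : Hom B C) (H : Hom C D) : (F.comp G).comp H = F.comp (G.comp H) := by
  unfold comp
  congr 1
  funext n w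
  ext z
  simp

theorem id_comp (F : Hom A B) : (id A).comp F = F := by
  cases F
  unfold comp
  congr 1
  funext n w
  ext z
  simp

theorem comp_id (F : Hom A B) : F.comp (id B) = F := by
  cases F
  unfold comp
  congr 1
  funext n w
  ext z
  simp

theorem eqToHom_nat {G H : Hom A B} (h : G = H) :
    (eqToHom h : G ⟶ H).nat = eqToHom (congrArg functor h) := by
  subst h
  rfl

/-- A natural isomorphism compatible with the coherence isomorphisms is an invertible 2-cell. -/
@[simps]
def isoMk {G H : Hom A B} (e : G.functor ≅ H.functor)
    (comm : ∀ {n : ℕ} (w : T.Word n) (z : Fin n → X),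
      (G.ρ w).hom.app z ≫ (B.Φ w).map (fun i => e.hom.app (z i)) =
        e.hom.app ((A.Φ w).obj z) ≫ (H.ρ w).hom.app z) : G ≅ H where
  hom := { nat := e.hom, comm := comm }
  inv :=
    { nat := e.inv
      comm := fun w z => by
        rw [← cancel_epi (e.hom.app ((A.Φ w).obj z)), ← reassoc_of% (comm w z), ← map_tuple_comp]
        simp [map_tuple_id] }
  hom_inv_id := by ext; simp
  inv_hom_id := by ext; simp

end Hom
end PseudoAlgebra

end Algebras

/-- A small pseudo `T`-algebra. -/
structure PsAlg (T : LawvereTheory.{w}) where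
  carrier : Type u
  [cat : SmallCategory carrier]
  alg : PseudoAlgebra T carrier

namespace PsAlg

attribute [instance] PsAlg.cat

variable {T : LawvereTheory.{w}}

theorem whisker_exchange_nat {X Y Z : PsAlg.{w, u} T} {F G : PseudoAlgebra.Hom X.alg Y.alg}
    {H K : PseudoAlgebra.Hom Y.alg Z.alg} (α : F ⟶ G) (β : H ⟶ K) :
    (PseudoAlgebra.Hom.whiskerLeft F β ≫ PseudoAlgebra.Hom.whiskerRight α K).nat =
      (PseudoAlgebra.Hom.whiskerRight α H ≫ PseudoAlgebra.Hom.whiskerLeft G β).nat := by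
  ext x
  simp

/-- The 2-category of small pseudo `T`-algebras, their morphisms and 2-cells, with the
compositions of the underlying functors and natural transformations. -/
instance : Bicategory (PsAlg.{w, u} T) where
  Hom X Y := PseudoAlgebra.Hom X.alg Y.alg
  id X := PseudoAlgebra.Hom.id X.alg
  comp G H := G.comp H
  homCategory X Y := inferInstanceAs (Category (PseudoAlgebra.Hom X.alg Y.alg))
  whiskerLeft G _ _ α := PseudoAlgebra.Hom.whiskerLeft G α
  whiskerRight α K := PseudoAlgebra.Hom.whiskerRight α K
  associator F G H := PseudoAlgebra.Hom.isoMk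
    (Functor.associator F.functor G.functor H.functor)
    (fun w z => by simp [PseudoAlgebra.Hom.map_tuple_id])
  leftUnitor F := PseudoAlgebra.Hom.isoMk (Functor.leftUnitor F.functor)
    (fun w z => by simp [PseudoAlgebra.Hom.map_tuple_id])
  rightUnitor F := PseudoAlgebra.Hom.isoMk (Functor.rightUnitor F.functor)
    (fun w z => by simp [PseudoAlgebra.Hom.map_tuple_id])
  whisker_exchange α β := PseudoAlgebra.Hom.hom_ext₂ (whisker_exchange_nat α β)

instance : Bicategory.Strict (PsAlg.{w, u} T) where
  id_comp F := PseudoAlgebra.Hom.id_comp F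
  comp_id F := PseudoAlgebra.Hom.comp_id F
  assoc F G H := PseudoAlgebra.Hom.comp_assoc F G H
  leftUnitor_eqToIso F := by
    apply Iso.ext
    apply PseudoAlgebra.Hom.hom_ext₂
    ext x
    erw [eqToIso.hom, PseudoAlgebra.Hom.eqToHom_nat, eqToHom_app]
  rightUnitor_eqToIso F := by
    apply Iso.ext
    apply PseudoAlgebra.Hom.hom_ext₂
    ext x
    erw [eqToIso.hom, PseudoAlgebra.Hom.eqToHom_nat, eqToHom_app]
  associator_eqToIso F G H := by
    apply Iso.ext
    apply PseudoAlgebra.Hom.hom_ext₂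
    ext x
    erw [eqToIso.hom, PseudoAlgebra.Hom.eqToHom_nat, eqToHom_app]

variable (T) in
/-- The forgetful 2-functor to the 2-category of small categories. -/
def forget : PsAlg.{w, u} T ⥤ᵖ Cat.{u, u} where
  obj X := Cat.of X.carrier
  map H := H.functor.toCatHom
  map₂ α := α.nat.toCatHom₂
  mapId X := Iso.refl _
  mapComp G H := Iso.refl _
  map₂_whisker_left f _ _ η := (Category.id_comp _).trans (Category.comp_id _) |>.symm
  map₂_whisker_right η h := (Category.id_comp _).trans (Category.comp_id _) |>.symm
  map₂_associator f g h := by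
    apply Cat.Hom₂.ext
    ext x
    have e : 𝟙 (h.functor.obj (g.functor.obj (f.functor.obj x))) =
        𝟙 _ ≫ h.functor.map (𝟙 _) ≫ 𝟙 _ ≫ 𝟙 _ ≫ 𝟙 _ := by simp
    exact e
  map₂_left_unitor f := by
    apply Cat.Hom₂.ext
    ext x
    have e (y) : 𝟙 (f.functor.obj y) = 𝟙 _ ≫ f.functor.map (𝟙 _) ≫ 𝟙 _ := by simp
    exact e x
  map₂_right_unitor f := by
    apply Cat.Hom₂.ext
    ext x
    have e : 𝟙 (f.functor.obj x) = 𝟙 _ ≫ 𝟙 _ ≫ 𝟙 _ := by simp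
    exact e

end PsAlg

section PseudoLimits

universe w₂ v₂ u₂ v₁ u₁

variable {J : Type u₁} [Category.{v₁} J] {B : Type u₂} [Bicategory.{w₂, v₂} B]

variable (J) in
/-- The constant 2-functor `Δ_X`. -/
abbrev constPF (X : B) : LocallyDiscrete J ⥤ᵖ B where
  obj _ := X
  map _ := 𝟙 X
  map₂ _ := 𝟙 (𝟙 X)
  mapId _ := Iso.refl (𝟙 X)
  mapComp _ _ := (λ_ (𝟙 X)).symm

/-- The category of pseudo cones from `X` to `F`, whose objects are the pseudo natural
transformations `Δ_X ⇒ F` and whose morphisms are the modifications. -/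
abbrev PseudoCone (X : B) (F : LocallyDiscrete J ⥤ᵖ B) := constPF J X ⟶ F

variable (J) in
/-- The transformation `Δ_b : Δ_X ⇒ Δ_Y` with all components equal to `b`. -/
abbrev constMap {X Y : B} (b : X ⟶ Y) : constPF J X ⟶ constPF J Y where
  app _ := b
  naturality _ := (λ_ b) ≪≫ (ρ_ b).symm

variable (J) in
/-- The modification with all components equal to `θ`. -/
abbrev constMap₂ {X Y : B} {b b' : X ⟶ Y} (θ : b ⟶ b') : constMap J b ⟶ constMap J b' where
  as := { app := fun _ => θ }

/-- The functor `(π ∘) : Mor(X, L) ⥤ PseudoCone(X, F)` of composition with a pseudo cone `π` on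
`L`, given by `b ↦ π ∘ b` and `θ ↦ π * θ`. -/
def PseudoCone.compose {L : B} {F : LocallyDiscrete J ⥤ᵖ B} (π : PseudoCone L F) (X : B) :
    (X ⟶ L) ⥤ PseudoCone X F where
  obj b := constMap J b ≫ π
  map θ := constMap₂ J θ ▷ π
  map_id b := by ext; simp
  map_comp θ θ' := by ext; simp

/-- A functor is an isomorphism of categories if it has a strict inverse. -/
def IsIsoOfCategories {C : Type*} [Category* C] {D : Type*} [Category* D] (P : C ⥤ D) : Prop :=
  ∃ Q : D ⥤ C, P ⋙ Q = 𝟭 C ∧ Q ⋙ P = 𝟭 D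

/-- The object `L` with the pseudo cone `π : Δ_L ⇒ F` is a pseudo limit of `F`. -/
def IsPseudoLimit {L : B} {F : LocallyDiscrete J ⥤ᵖ B} (π : PseudoCone L F) : Prop :=
  ∀ X : B, IsIsoOfCategories (π.compose X)

end PseudoLimits

section Explicit

open LawvereTheory

variable {T : LawvereTheory.{w}} {J : Type u} [SmallCategory J]
  (F : LocallyDiscrete J ⥤ᵖ PsAlg.{w, u} T)

/-- The category `PseudoCone(𝟏, U ∘ F)` of pseudo cones on a point, where `U` is the forgetful
2-functor to small categories and `𝟏` is the terminal category. -/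
abbrev PointCone : Type u :=
  PseudoCone (Cat.of (Discrete PUnit.{u + 1})) (F.comp (PsAlg.forget T))

/-- The evaluation functor `η ↦ η_j(∗)`, `Θ ↦ Θ_j(∗)`. -/
def evalPoint (j : LocallyDiscrete J) : PointCone F ⥤ (F.obj j).carrier where
  obj η := (η.app j).toFunctor.obj ⟨⟨⟩⟩
  map Θ := (Θ.as.app j).toNatTrans.app ⟨⟨⟩⟩

/-- The isomorphism `τ^η(f)_∗ : F f (η_i(∗)) ≅ η_j(∗)` of a pseudo cone `η` on a point, for
`f : i ⟶ j`. -/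
def pointIso {i j : LocallyDiscrete J} (f : i ⟶ j) (η : PointCone F) :
    (F.map f).functor.obj ((evalPoint F i).obj η) ≅ (evalPoint F j).obj η :=
  (Cat.Hom.toNatIso (η.naturality f).symm).app ⟨⟨⟩⟩

/-- The structure `A` of a pseudo algebra on `PseudoCone(𝟏, U ∘ F)` is defined componentwise. -/
structure IsComponentwise (A : PseudoAlgebra T (PointCone F)) : Prop where
  /-- `(Φ(w)(η¹, …, ηⁿ))_j(∗) = Φ_j(w)(η¹_j(∗), …, ηⁿ_j(∗))`, and likewise for morphisms. -/
  Φ_eval (j : LocallyDiscrete J) {n : ℕ} (w : T.Word n) :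
    A.Φ w ⋙ evalPoint F j = powerF (evalPoint F j) n ⋙ (F.obj j).alg.Φ w
  /-- The isomorphism of `Φ(w)(η¹, …, ηⁿ)` at `f` is `Φ_j(w)(τ^{η¹}(f), …, τ^{ηⁿ}(f)) ∘ ρ^{F f}_w`. -/
  Φ_iso {i j : LocallyDiscrete J} (f : i ⟶ j) {n : ℕ} (w : T.Word n) (η : Fin n → PointCone F) :
    (pointIso F f ((A.Φ w).obj η)).hom =
      eqToHom (congrArg (F.map f).functor.obj (Functor.congr_obj (Φ_eval i w) η)) ≫
        ((F.map f).ρ w).hom.app (fun l => (evalPoint F i).obj (η l)) ≫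
        ((F.obj j).alg.Φ w).map (fun l => (pointIso F f (η l)).hom) ≫
        eqToHom (Functor.congr_obj (Φ_eval j w) η).symm
  /-- The coherence isomorphisms of `A` have those of the algebras `F j` as components. -/
  c_eval (j : LocallyDiscrete J) {k : ℕ} {n : Fin k → ℕ} (w : T.Word k)
      (ws : ∀ i, T.Word (n i)) (η : Fin (∑ i, n i) → PointCone F) :
    (evalPoint F j).map ((A.c w ws).hom.app η) =
      eqToHom (Functor.congr_obj (Φ_eval j (gamma w ws)) η) ≫
        ((F.obj j).alg.c w ws).hom.app (fun p => (evalPoint F j).obj (η p)) ≫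
        eqToHom (((Functor.congr_obj (Φ_eval j w) _).trans
          (congrArg ((F.obj j).alg.Φ w).obj
            (funext fun i => Functor.congr_obj (Φ_eval j (ws i)) _))).symm)
  I_eval (j : LocallyDiscrete J) (η : Fin 1 → PointCone F) :
    (evalPoint F j).map (A.I.hom.app η) =
      eqToHom (Functor.congr_obj (Φ_eval j T.one) η) ≫
        (F.obj j).alg.I.hom.app (fun p => (evalPoint F j).obj (η p))
  s_eval (j : LocallyDiscrete J) {m n : ℕ} (f : Fin m → Fin n) (w : T.Word m)
      (η : Fin n → PointCone F) :
    (evalPoint F j).map ((A.s f w).hom.app η) =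
      eqToHom (Functor.congr_obj (Φ_eval j (subst f w)) η) ≫
        ((F.obj j).alg.s f w).hom.app (fun p => (evalPoint F j).obj (η p)) ≫
        eqToHom (Functor.congr_obj (Φ_eval j w) _).symm

/-- The pseudo cone `π` on the pseudo algebra `L = PseudoCone(𝟏, U ∘ F)` is given by evaluation:
`π_j` is the evaluation at `∗`, as a strict morphism of algebras, and the coherence 2-cell
`F f ∘ π_i ⇒ π_j` has the component `τ^η(f)_∗` at `η`. -/
structure IsEvaluation (A : PseudoAlgebra T (PointCone F))
    (π : PseudoCone (B := PsAlg.{w, u} T) ⟨PointCone F, A⟩ F) : Prop where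
  functor_eq (j : LocallyDiscrete J) : (π.app j).functor = evalPoint F j
  ρ_eq (j : LocallyDiscrete J) {n : ℕ} (w : T.Word n) (η : Fin n → PointCone F) :
    ∃ h, ((π.app j).ρ w).hom.app η = eqToHom h
  τ_eq {i j : LocallyDiscrete J} (f : i ⟶ j) (η : PointCone F) :
    (π.naturality f).inv.nat.app η =
      eqToHom (congrArg (F.map f).functor.obj (Functor.congr_obj (functor_eq i) η)) ≫
        (pointIso F f η).hom ≫ eqToHom (Functor.congr_obj (functor_eq j) η).symm

end Explicit

/-!
A pseudo cone `η` on a point is a family of objects `η_j(∗)` of the algebras `F j` together with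
isomorphisms `τ^η(f) : F f (η_i(∗)) ≅ η_j(∗)` that satisfy one equation for identities and one for
composites (`PointCone.mk`, `PointCone.pointIso_id`, `PointCone.pointIso_comp`); a morphism of such
cones is a family of morphisms that commutes with the `τ(f)` (`PointCone.homMk`). Equalities of
morphisms can be checked after all evaluations (`PointCone.hom_ext`).

*The algebra.* A morphism of algebras `H : A ⟶ B` and isomorphisms `H (x l) ≅ y l` give an
isomorphism `H (Φ(w)(x₁, …, xₙ)) ≅ Φ(w)(y₁, …, yₙ)`, the transport along `w`
(`PseudoAlgebra.Hom.transport`). The axioms of a morphism of algebras say that transport commutes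
with the coherence isomorphisms `c`, `I`, `s`, and the axiom of a 2-cell that it commutes with
2-cells. With `H = F f` this shows that the componentwise operations of point cones are again point
cones, and that the coherence isomorphisms of the algebras `F j` are morphisms of point cones. Their
coherence diagrams commute because they do so in every `F j` (`PointCone.alg`). Evaluation is then a
pseudo cone of algebras (`PointCone.evalCone`).

*The universal property.* For a pseudo cone `κ` on an algebra `V`, each object `v` of `V` gives a
point cone `κ_j(v)`, and the 2-cell condition on `κ` makes the isomorphisms `ρ` of the `κ_j` into
morphisms of point cones. So `κ` factors through evaluation by `PointCone.lift κ`, and `lift` is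
a strict two-sided inverse, on objects, of the composition with `evalCone`. This composition is
fully faithful: a modification is the same thing as a family of morphisms of point cones that is
natural and compatible with `ρ`. A fully faithful functor that is bijective on objects is an
isomorphism of categories.

Evaluations of the constructed point cones compute by definition, so the `eqToHom`s in the statement
are definitionally identities, and so are the components of the unitors and associators of both
2-categories. Several proofs therefore state a local fact `e` about an arbitrary category, in which
these identities are written as `𝟙 _`, and apply it up to definitional equality.
-/

open LawvereTheory

/-! ### Strict equalities in bicategories and categories -/

/-- Transformations with equal components are equal if their 2-cells agree up to the induced
`eqToHom`s. The inverse 2-cells are compared because these are the `τ(f)` of a pseudo cone. -/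
theorem strongTrans_ext {B : Type*} [Bicategory B] {C : Type*} [Bicategory C] {F G : B ⥤ᵖ C}
    {η θ : F ⟶ G} (h : ∀ a, η.app a = θ.app a)
    (hn : ∀ {a b : B} (f : a ⟶ b), (η.naturality f).inv ≫ F.map f ◁ eqToHom (h b) =
      eqToHom (h a) ▷ G.map f ≫ (θ.naturality f).inv) : η = θ := by
  obtain ⟨app, nat, _, _, _⟩ := η
  obtain ⟨app', nat', _, _, _⟩ := θ
  obtain rfl : app = app' := funext h
  have : @nat = @nat' := by
    funext a b f
    apply Iso.symm_eq_iff.mp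
    ext
    simpa using hn f
  subst this
  rfl

theorem functor_punit_ext {C : Type*} [Category C] {G H : Discrete PUnit.{u + 1} ⥤ C}
    (h : G.obj ⟨⟨⟩⟩ = H.obj ⟨⟨⟩⟩) : G = H := by
  refine CategoryTheory.Functor.ext (fun _ => h) fun a b f => ?_
  obtain rfl : a = b := Subsingleton.elim _ _
  obtain rfl : f = 𝟙 _ := Subsingleton.elim _ _
  simp

/-- A fully faithful functor that is bijective on objects has a strict inverse. -/
theorem isIsoOfCategories_of_fullyFaithful {C : Type*} [Category* C] {D : Type*} [Category* D]
    (P : C ⥤ D) [P.Full] [P.Faithful] (g : D → C) (hg : ∀ c, g (P.obj c) = c)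
    (hg' : ∀ d, P.obj (g d) = d) : IsIsoOfCategories P := by
  -- The strict inverse conjugates with `eqToHom` and takes preimages.
  let Q : D ⥤ C :=
    { obj := g
      map := fun f => P.preimage (eqToHom (hg' _) ≫ f ≫ eqToHom (hg' _).symm)
      map_id := fun d => P.map_injective (by simp)
      map_comp := fun f f' => P.map_injective (by simp) }
  refine ⟨Q, CategoryTheory.Functor.ext hg fun c c' f => P.map_injective ?_,
    CategoryTheory.Functor.ext hg' fun d d' f => ?_⟩
  · simp [Q, eqToHom_map]
  · simp [Q]

/-! ### Pseudo cones on a point -/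

namespace PointCone

variable {T : LawvereTheory.{w}} {J : Type u} [SmallCategory J]
  {F : LocallyDiscrete J ⥤ᵖ PsAlg.{w, u} T}

theorem pointIso_id (η : PointCone F) (j : LocallyDiscrete J) :
    (pointIso F (𝟙 j) η).hom = (F.mapId j).hom.nat.app ((evalPoint F j).obj η) := by
  have h := congrArg (fun e => e.toNatTrans.app ⟨⟨⟩⟩)
    (Pseudofunctor.StrongTrans.naturality_id_inv η j)
  refine h.trans ?_
  have e : (F.mapId j).hom.nat.app ((evalPoint F j).obj η) =
    ((F.mapId j).hom.nat.app ((evalPoint F j).obj η) ≫ 𝟙 _) ≫ 𝟙 _ ≫ 𝟙 _ ≫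
      (η.app j).toFunctor.map (𝟙 _) := by
      -- The functor `η.app j` on the point preserves the identity only propositionally.
      have := (η.app j).toFunctor.map_id ⟨⟨⟩⟩
      erw [this, Category.comp_id, Category.comp_id, Category.comp_id, Category.comp_id]
  rw [e]
  rfl

theorem pointIso_comp (η : PointCone F) {i j k : LocallyDiscrete J} (f : i ⟶ j) (g : j ⟶ k) :
    (pointIso F (f ≫ g) η).hom = (F.mapComp f g).hom.nat.app ((evalPoint F i).obj η) ≫
      (F.map g).functor.map (pointIso F f η).hom ≫ (pointIso F g η).hom := by
  have h := congrArg (fun e => e.toNatTrans.app ⟨⟨⟩⟩)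
    (Pseudofunctor.StrongTrans.naturality_comp_inv η f g)
  refine h.trans ?_
  have e : (F.mapComp f g).hom.nat.app ((evalPoint F i).obj η) ≫
      (F.map g).functor.map (pointIso F f η).hom ≫ (pointIso F g η).hom =
     ((F.mapComp f g).hom.nat.app ((evalPoint F i).obj η) ≫ 𝟙 _) ≫ 𝟙 _ ≫
      (F.map g).functor.map (pointIso F f η).hom ≫ 𝟙 _ ≫ (pointIso F g η).hom ≫ 𝟙 _ ≫
        (η.app k).toFunctor.map (𝟙 _) := by
      have := (η.app k).toFunctor.map_id ⟨⟨⟩⟩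
      erw [this, Category.comp_id, Category.comp_id, Category.comp_id, Category.id_comp,
        Category.id_comp]
      rfl
  rw [e]
  rfl

/-- The modification axiom, as the naturality of `τ(f)` in the point cone. -/
theorem eval_naturality {η θ : PointCone F} (Θ : η ⟶ θ) {i j : LocallyDiscrete J} (f : i ⟶ j) :
    (F.map f).functor.map ((evalPoint F i).map Θ) ≫ (pointIso F f θ).hom =
      (pointIso F f η).hom ≫ (evalPoint F j).map Θ := by
  have h := congrArg (fun e => e.toNatTrans.app ⟨⟨⟩⟩) (Θ.as.naturality f)
  have h' : (evalPoint F j).map Θ ≫ (pointIso F f θ).inv =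
    (pointIso F f η).inv ≫ (F.map f).functor.map ((evalPoint F i).map Θ) := h
  rw [← Iso.inv_comp_eq, ← Category.assoc, ← h', Category.assoc, Iso.inv_hom_id, Category.comp_id]

/-- The pseudo cone on a point with `η_j(∗) = x j` and `τ^η(f)_∗ = τ f`. The coherence 2-cells of
a strong transformation are the inverses of the `τ f`. -/
def mk (x : ∀ j : LocallyDiscrete J, (F.obj j).carrier)
    (τ : ∀ {i j : LocallyDiscrete J} (f : i ⟶ j), (F.map f).functor.obj (x i) ≅ x j)
    (τ_id : ∀ j, (τ (𝟙 j)).hom = (F.mapId j).hom.nat.app (x j))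
    (τ_comp : ∀ {i j k : LocallyDiscrete J} (f : i ⟶ j) (g : j ⟶ k),
      (τ (f ≫ g)).hom = (F.mapComp f g).hom.nat.app (x i) ≫
        (F.map g).functor.map (τ f).hom ≫ (τ g).hom) : PointCone F where
  app j := ((Functor.const _).obj (x j)).toCatHom
  naturality f := Cat.Hom.isoMk
    (F := (Functor.const (Discrete PUnit.{u + 1})).obj (x _))
    (G := (Functor.const (Discrete PUnit.{u + 1})).obj (x _) ⋙ (F.map f).functor)
    (NatIso.ofComponents (fun _ => (τ f).symm) (fun _ => by simp))
  naturality_naturality {i j f g} α := by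
    obtain rfl := LocallyDiscrete.eq_of_hom α
    obtain rfl : α = 𝟙 f := Subsingleton.elim _ _
    rw [PrelaxFunctor.map₂_id, PrelaxFunctor.map₂_id]
    apply Cat.Hom₂.ext
    ext z
    have h : 𝟙 _ ≫ (τ f).inv = (τ f).inv ≫ 𝟙 _ := by simp
    exact h
  naturality_id j := by
    apply Cat.Hom₂.ext
    ext z
    have h : (τ (𝟙 j)).inv ≫ (F.mapId j).hom.nat.app (x j) ≫ 𝟙 _ = 𝟙 _ ≫ 𝟙 _ ≫ 𝟙 _ := by
      rw [← τ_id]; simp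
    exact h
  naturality_comp {i j k} f g := by
    apply Cat.Hom₂.ext
    ext z
    have h : (τ (f ≫ g)).inv ≫ (F.mapComp f g).hom.nat.app (x i) ≫ 𝟙 _ =
      𝟙 _ ≫ 𝟙 _ ≫ (τ g).inv ≫ 𝟙 _ ≫ (F.map g).functor.map (τ f).inv ≫ 𝟙 _ := by
      rw [Iso.inv_comp_eq, τ_comp]
      simp [← CategoryTheory.Functor.map_comp]
      erw [Category.comp_id]
    exact h

/-- The morphism of point cones with components `h j`. -/
def homMk {η θ : PointCone F}
    (h : ∀ j : LocallyDiscrete J, (evalPoint F j).obj η ⟶ (evalPoint F j).obj θ)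
    (comm : ∀ {i j : LocallyDiscrete J} (f : i ⟶ j),
      (F.map f).functor.map (h i) ≫ (pointIso F f θ).hom = (pointIso F f η).hom ≫ h j) :
    η ⟶ θ where
  as :=
    { app j := NatTrans.toCatHom₂ (C := Discrete PUnit.{u+1}) (F := (η.app j).toFunctor)
        (G := (θ.app j).toFunctor)
        (Discrete.natTrans fun _ => h j)
      naturality {i j} f := by
        apply Cat.Hom₂.ext
        ext z
        have e : h j ≫ (pointIso F f θ).inv =
            (pointIso F f η).inv ≫ (F.map f).functor.map (h i) := by
          rw [Iso.comp_inv_eq, Category.assoc, comm, Iso.inv_hom_id_assoc]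
        exact e }

theorem hom_ext {η θ : PointCone F} {α β : η ⟶ θ}
    (h : ∀ j, (evalPoint F j).map α = (evalPoint F j).map β) : α = β := by
  apply Pseudofunctor.StrongTrans.homCategory.ext
  intro j
  apply Cat.Hom₂.ext
  ext z
  exact h j

/-- Point cones are equal if they have equal objects `η_j(∗)` and, up to the induced `eqToHom`s,
equal isomorphisms `τ(f)_∗`. -/
theorem ext {η θ : PointCone F} (h : ∀ j, (evalPoint F j).obj η = (evalPoint F j).obj θ)
    (hτ : ∀ {i j : LocallyDiscrete J} (f : i ⟶ j), (pointIso F f η).hom =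
      eqToHom (congrArg (F.map f).functor.obj (h i)) ≫ (pointIso F f θ).hom ≫
        eqToHom (h j).symm) : η = θ := by
  have h' (j) : η.app j = θ.app j :=
    Cat.ext (functor_punit_ext (h j))
  refine strongTrans_ext h' fun {i j} f => ?_
  apply Cat.Hom₂.ext
  ext z
  have e : (pointIso F f η).hom ≫ (eqToHom (h' j)).toNatTrans.app z =
    (F.map f).functor.map ((eqToHom (h' i)).toNatTrans.app z) ≫ (pointIso F f θ).hom := by
    rw [Cat.eqToHom_app, Cat.eqToHom_app, hτ]
    erw [Category.assoc, Category.assoc, eqToHom_trans, eqToHom_map, eqToHom_refl,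
      Category.comp_id]
    rfl
  exact e

end PointCone

/-! ### Transport of isomorphisms along operations -/

namespace PseudoAlgebra.Hom

variable {T : LawvereTheory.{w}} {X : Type u} [Category.{v} X] {Y : Type u} [Category.{v} Y]
  {Z : Type u} [Category.{v} Z] {A : PseudoAlgebra T X} {B : PseudoAlgebra T Y}
  {C : PseudoAlgebra T Z}

/-- The isomorphism `Φ(w)(τ₁, …, τₙ) ∘ ρ_w : H (Φ(w)(x₁, …, xₙ)) ≅ Φ(w)(y₁, …, yₙ)` induced by
isomorphisms `τ_l : H (x_l) ≅ y_l`. -/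
def transport (H : Hom A B) {n : ℕ} (w : T.Word n) {x : Fin n → X} {y : Fin n → Y}
    (τ : ∀ l, H.functor.obj (x l) ≅ y l) :
    H.functor.obj ((A.Φ w).obj x) ≅ (B.Φ w).obj y :=
  (H.ρ w).app x ≪≫ (B.Φ w).mapIso (X := fun l => H.functor.obj (x l)) (Y := y)
    (Iso.mk (fun l => (τ l).hom) (fun l => (τ l).inv) (funext fun l => (τ l).hom_inv_id)
      (funext fun l => (τ l).inv_hom_id))

theorem transport_hom (H : Hom A B) {n : ℕ} (w : T.Word n) {x : Fin n → X} {y : Fin n → Y}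
    (τ : ∀ l, H.functor.obj (x l) ≅ y l) :
    (H.transport w τ).hom = (H.ρ w).hom.app x ≫
      (B.Φ w).map (X := fun l => H.functor.obj (x l)) (Y := y) (fun l => (τ l).hom) :=
  rfl

theorem transport_naturality (H : Hom A B) {n : ℕ} (w : T.Word n) {x x' : Fin n → X}
    {y y' : Fin n → Y} (τ : ∀ l, H.functor.obj (x l) ≅ y l) (τ' : ∀ l, H.functor.obj (x' l) ≅ y' l)
    (a : ∀ l, x l ⟶ x' l) (b : ∀ l, y l ⟶ y' l)
    (h : ∀ l, H.functor.map (a l) ≫ (τ' l).hom = (τ l).hom ≫ b l) :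
    H.functor.map ((A.Φ w).map (X := x) (Y := x') a) ≫ (H.transport w τ').hom =
      (H.transport w τ).hom ≫ (B.Φ w).map (X := y) (Y := y') b := by
  rw [transport_hom, transport_hom, ρ_naturality_assoc, Category.assoc, ← map_tuple_comp,
    ← map_tuple_comp]
  simp only [h]

/-- Transport along `γ(w, w₁, …, w_k)` is transport along the `w_i` followed by transport along `w`,
up to `c`. This is the axiom `ρ_gamma` and the naturality of `c`. -/
theorem transport_gamma (H : Hom A B) {k : ℕ} {n : Fin k → ℕ} (w : T.Word k)
    (ws : ∀ i, T.Word (n i)) {x : Fin (∑ i, n i) → X} {y : Fin (∑ i, n i) → Y}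
    (τ : ∀ l, H.functor.obj (x l) ≅ y l) :
    H.functor.map ((A.c w ws).hom.app x) ≫
        (H.transport w fun i => H.transport (ws i) fun j => τ (blockIncl i j)).hom =
      (H.transport (gamma w ws) τ).hom ≫ (B.c w ws).hom.app y := by
  have h := (B.c w ws).hom.naturality (X := fun l => H.functor.obj (x l)) (Y := y)
    fun l => (τ l).hom
  dsimp only at h
  rw [transport_hom (w := gamma w ws), Category.assoc, h, ← Category.assoc, H.ρ_gamma,
    transport_hom]
  simp only [transport_hom]
  rw [map_tuple_comp]
  simp only [Category.assoc]

theorem transport_one (H : Hom A B) {x : Fin 1 → X} {y : Fin 1 → Y}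
    (τ : ∀ l, H.functor.obj (x l) ≅ y l) :
    H.functor.map (A.I.hom.app x) ≫ (τ 0).hom = (H.transport T.one τ).hom ≫ B.I.hom.app y := by
  have h := B.I.hom.naturality (X := fun l => H.functor.obj (x l)) (Y := y) fun l => (τ l).hom
  dsimp only at h
  rw [transport_hom, Category.assoc, h, ← Category.assoc, H.ρ_one]

theorem transport_subst (H : Hom A B) {m n : ℕ} (f : Fin m → Fin n) (w : T.Word m)
    {x : Fin n → X} {y : Fin n → Y} (τ : ∀ l, H.functor.obj (x l) ≅ y l) :
    H.functor.map ((A.s f w).hom.app x) ≫ (H.transport w fun i => τ (f i)).hom =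
      (H.transport (subst f w) τ).hom ≫ (B.s f w).hom.app y := by
  have h := (B.s f w).hom.naturality (X := fun l => H.functor.obj (x l)) (Y := y)
    fun l => (τ l).hom
  dsimp only at h
  rw [transport_hom (w := subst f w), Category.assoc, h, ← Category.assoc, H.ρ_subst,
    transport_hom, Category.assoc]

/-- For `α : H ⇒ id`, the transport of components of `α` is a component of `α`. -/
theorem transport_id {H : Hom A A} (α : H ⟶ id A) {n : ℕ} (w : T.Word n)
    {x : Fin n → X} (τ : ∀ l, H.functor.obj (x l) ≅ x l) (h : ∀ l, (τ l).hom = α.nat.app (x l)) :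
    (H.transport w τ).hom = α.nat.app ((A.Φ w).obj x) := by
  rw [transport_hom]
  simp only [h]
  rw [α.comm w x]
  exact Category.comp_id _

/-- For `α : K ⇒ H ∘ G`, if each `υ l` is the composite of `σ l` and `τ l` along `α`, then so is
the transport of `υ` with respect to those of `σ` and `τ`. -/
theorem transport_comp {G : Hom A B} {H : Hom B C} {K : Hom A C} (α : K ⟶ G.comp H) {n : ℕ}
    (w : T.Word n) {x : Fin n → X} {y : Fin n → Y} {z : Fin n → Z}
    (σ : ∀ l, G.functor.obj (x l) ≅ y l) (τ : ∀ l, H.functor.obj (y l) ≅ z l)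
    (υ : ∀ l, K.functor.obj (x l) ≅ z l)
    (h : ∀ l, (υ l).hom = α.nat.app (x l) ≫ H.functor.map (σ l).hom ≫ (τ l).hom) :
    (K.transport w υ).hom = α.nat.app ((A.Φ w).obj x) ≫
      H.functor.map (G.transport w σ).hom ≫ (H.transport w τ).hom := by
  rw [transport_hom, transport_hom, transport_hom]
  simp only [h]
  rw [map_tuple_comp, map_tuple_comp, α.comm_assoc w x, Functor.map_comp_assoc,
    ρ_naturality_assoc]
  simp

end PseudoAlgebra.Hom

/-! ### The algebra of point cones -/

namespace PointCone

open PseudoAlgebra.Hom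

variable {T : LawvereTheory.{w}} {J : Type u} [SmallCategory J]
  {F : LocallyDiscrete J ⥤ᵖ PsAlg.{w, u} T}

@[simp]
theorem eval_homMk {η θ : PointCone F}
    (h : ∀ j : LocallyDiscrete J, (evalPoint F j).obj η ⟶ (evalPoint F j).obj θ)
    (comm : ∀ {i j : LocallyDiscrete J} (f : i ⟶ j),
      (F.map f).functor.map (h i) ≫ (pointIso F f θ).hom = (pointIso F f η).hom ≫ h j)
    (j : LocallyDiscrete J) : (evalPoint F j).map (homMk h comm) = h j :=
  rfl

/-- The isomorphism of point cones with components `h j`. -/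
def isoMk {η θ : PointCone F}
    (h : ∀ j : LocallyDiscrete J, (evalPoint F j).obj η ≅ (evalPoint F j).obj θ)
    (comm : ∀ {i j : LocallyDiscrete J} (f : i ⟶ j),
      (F.map f).functor.map (h i).hom ≫ (pointIso F f θ).hom =
        (pointIso F f η).hom ≫ (h j).hom) : η ≅ θ where
  hom := homMk (fun j => (h j).hom) comm
  inv := homMk (fun j => (h j).inv) fun {i j} f => by
    rw [Iso.eq_comp_inv, Category.assoc, ← comm, ← Functor.map_comp_assoc, Iso.inv_hom_id,
      CategoryTheory.Functor.map_id, Category.id_comp]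
  hom_inv_id := hom_ext fun j => by simp
  inv_hom_id := hom_ext fun j => by simp

/-- The point cone `Φ(w)(η¹, …, ηⁿ)`, with objects `Φ_j(w)(η¹_j(∗), …, ηⁿ_j(∗))` and with the
transports along `F f` of the isomorphisms `τ^{η^l}(f)`. -/
def opObj {n : ℕ} (w : T.Word n) (η : Fin n → PointCone F) : PointCone F :=
  mk (fun j => ((F.obj j).alg.Φ w).obj fun l => (evalPoint F j).obj (η l))
    (fun f => (F.map f).transport w fun l => pointIso F f (η l))
    (fun j => transport_id (F.mapId j).hom w _ fun l => pointIso_id (η l) j)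
    (fun f g => transport_comp (F.mapComp f g).hom w _ _ _ fun l => pointIso_comp (η l) f g)

/-- The functor `Φ(w)` on point cones. -/
def op {n : ℕ} (w : T.Word n) : (Fin n → PointCone F) ⥤ PointCone F where
  obj η := opObj w η
  map {η θ} Θ := homMk
    (fun j => ((F.obj j).alg.Φ w).map (X := fun l => (evalPoint F j).obj (η l))
      (Y := fun l => (evalPoint F j).obj (θ l)) fun l => (evalPoint F j).map (Θ l))
    fun f => transport_naturality (F.map f) w _ _ _ _ fun l => eval_naturality (Θ l) f
  map_id η := hom_ext fun j =>
    ((powerF (evalPoint F j) n ⋙ (F.obj j).alg.Φ w).map_id η).trans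
      (CategoryTheory.Functor.map_id (evalPoint F j) (opObj w η)).symm
  map_comp Θ Θ' := hom_ext fun j => by
    rw [CategoryTheory.Functor.map_comp]
    exact (powerF (evalPoint F j) n ⋙ (F.obj j).alg.Φ w).map_comp Θ Θ'

variable (F) in
/-- The componentwise structure of a pseudo algebra on the category of point cones. Each coherence
diagram is evaluated at every `j`, where it is a coherence diagram of `F j`. -/
def alg : PseudoAlgebra T (PointCone F) where
  Φ := op
  c w ws := NatIso.ofComponents
    (fun η => isoMk (fun j => ((F.obj j).alg.c w ws).app fun p => (evalPoint F j).obj (η p))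
      fun f => transport_gamma (F.map f) w ws fun p => pointIso F f (η p))
    fun {η θ} Θ => hom_ext fun j => by
      have := ((F.obj j).alg.c w ws).hom.naturality (X := fun p => (evalPoint F j).obj (η p))
        (Y := fun p => (evalPoint F j).obj (θ p)) fun p => (evalPoint F j).map (Θ p)
      rw [Functor.map_comp, Functor.map_comp]
      exact this
  I := NatIso.ofComponents
    (fun η => isoMk (fun j => (F.obj j).alg.I.app fun p => (evalPoint F j).obj (η p))
      fun f => transport_one (F.map f) fun p => pointIso F f (η p))
    fun {η θ} Θ => hom_ext fun j => by
      have := (F.obj j).alg.I.hom.naturality (X := fun p => (evalPoint F j).obj (η p))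
        (Y := fun p => (evalPoint F j).obj (θ p)) fun p => (evalPoint F j).map (Θ p)
      rw [Functor.map_comp, Functor.map_comp]
      exact this
  s g w := NatIso.ofComponents
    (fun η => isoMk (fun j => ((F.obj j).alg.s g w).app fun p => (evalPoint F j).obj (η p))
      fun f => transport_subst (F.map f) g w fun p => pointIso F f (η p))
    fun {η θ} Θ => hom_ext fun j => by
      have := ((F.obj j).alg.s g w).hom.naturality (X := fun p => (evalPoint F j).obj (η p))
        (Y := fun p => (evalPoint F j).obj (θ p)) fun p => (evalPoint F j).map (Θ p)
      rw [Functor.map_comp, Functor.map_comp]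
      exact this
  c_assoc w v u η := hom_ext fun j => by
    have := (F.obj j).alg.c_assoc w v u fun p => (evalPoint F j).obj (η p)
    simp only [Functor.map_comp, eqToHom_map]
    exact this
  c_one_right w η := hom_ext fun j => by
    have := (F.obj j).alg.c_one_right w fun p => (evalPoint F j).obj (η p)
    simp only [Functor.map_comp, eqToHom_map]
    exact this
  c_one_left w η := hom_ext fun j => by
    have := (F.obj j).alg.c_one_left w fun p => (evalPoint F j).obj (η p)
    simp only [Functor.map_comp, eqToHom_map]
    exact this
  c_subst_left f _ w ws η := hom_ext fun j => by
    have := (F.obj j).alg.c_subst_left f w ws fun p => (evalPoint F j).obj (η p)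
    simp only [Functor.map_comp, eqToHom_map]
    exact this
  c_subst_right f w ws η := hom_ext fun j => by
    have := (F.obj j).alg.c_subst_right f w ws fun p => (evalPoint F j).obj (η p)
    simp only [Functor.map_comp, eqToHom_map]
    exact this
  s_comp f g w η := hom_ext fun j => by
    have := (F.obj j).alg.s_comp f g w fun p => (evalPoint F j).obj (η p)
    simp only [Functor.map_comp, eqToHom_map]
    exact this
  s_id w η := hom_ext fun j => by
    have := (F.obj j).alg.s_id w fun p => (evalPoint F j).obj (η p)
    simp only [eqToHom_map]
    exact this

variable (F) in
theorem alg_isComponentwise : IsComponentwise F (alg F) where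
  Φ_eval j n w := rfl
  Φ_iso {i j} f n w η := by
    have e {C : Type u} [Category.{u} C] {a b c : C} (p : a ⟶ b) (q : b ⟶ c) :
      p ≫ q = 𝟙 _ ≫ p ≫ q ≫ 𝟙 _ := by simp
    exact e (((F.map f).ρ w).hom.app fun l => (evalPoint F i).obj (η l))
      (((F.obj j).alg.Φ w).map fun l => (pointIso F f (η l)).hom)
  c_eval j k n w ws η := (Category.comp_id _).symm.trans (Category.id_comp _).symm
  I_eval j η := (Category.id_comp _).symm
  s_eval j m n f w η := (Category.comp_id _).symm.trans (Category.id_comp _).symm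

end PointCone

/-! ### Equality of morphisms of algebras -/

namespace PseudoAlgebra.Hom

variable {T : LawvereTheory.{w}} {X : Type u} [Category.{v} X] {Y : Type u} [Category.{v} Y]
  {A : PseudoAlgebra T X} {B : PseudoAlgebra T Y}

/-- Morphisms of algebras are equal if their functors are equal and their `ρ`s agree up to the
induced `eqToHom`. -/
theorem ext_of_functor_eq {G H : Hom A B} (h : G.functor = H.functor)
    (hρ : ∀ {n : ℕ} (w : T.Word n) (z : Fin n → X),
      (G.ρ w).hom.app z ≫ (B.Φ w).map (fun i => (eqToHom h).app (z i)) =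
        (eqToHom h).app ((A.Φ w).obj z) ≫ (H.ρ w).hom.app z) : G = H := by
  obtain ⟨functor, ρ, _, _, _⟩ := G
  obtain ⟨functor', ρ', _, _, _⟩ := H
  obtain rfl : functor = functor' := h
  have : @ρ = @ρ' := by
    funext n w
    ext z
    have := hρ w z
    simp only [eqToHom_refl, NatTrans.id_app, Category.id_comp] at this
    rw [map_tuple_id] at this
    simpa using this
  subst this
  rfl

end PseudoAlgebra.Hom

/-! ### The evaluation cone -/

namespace PointCone

open PseudoAlgebra.Hom

variable {T : LawvereTheory.{w}} {J : Type u} [SmallCategory J]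
  (F : LocallyDiscrete J ⥤ᵖ PsAlg.{w, u} T)

/-- The category of point cones as an object of the 2-category of small pseudo algebras. -/
abbrev psAlg : PsAlg.{w, u} T := ⟨PointCone F, alg F⟩

/-- The evaluation at `j` as a strict morphism of algebras: all `ρ_w` are identities. -/
def evalHom (j : LocallyDiscrete J) : psAlg F ⟶ F.obj j :=
  { functor := evalPoint F j
    ρ := fun {n} w => NatIso.ofComponents (fun η => Iso.refl _) fun {η θ} Θ =>
      (Category.comp_id _).trans (Category.id_comp _).symm
    ρ_gamma := fun w ws z => by
      have := map_tuple_id ((F.obj j).alg.Φ w) fun i => ((F.obj j).alg.Φ (ws i)).obj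
          fun q => (evalPoint F j).obj (z (blockIncl i q))
      refine (Category.id_comp _).trans (Eq.symm ?_)
      refine (congrArg (_ ≫ ·) ((Category.id_comp _).trans this)).trans ?_
      exact Category.comp_id _
    ρ_one := fun z => Category.id_comp _
    ρ_subst := fun f w z => (Category.id_comp _).trans (Category.comp_id _).symm }

/-- The invertible 2-cell `F f ∘ ev_i ⇒ ev_j` with the component `τ^η(f)_∗` at `η`. -/
def evalIso {i j : LocallyDiscrete J} (f : i ⟶ j) : evalHom F i ≫ F.map f ≅ evalHom F j :=
  PseudoAlgebra.Hom.isoMk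
    (NatIso.ofComponents (fun η => pointIso F f η) fun Θ => eval_naturality Θ f)
    fun {n} w η => by
      have e {C : Type u} [Category.{u} C] {a b c d : C} (p : a ⟶ b) (q : b ⟶ c) (r : d ⟶ a)
        (hr : d = a) (h : r = eqToHom hr) : (r ≫ p) ≫ q = (eqToHom hr ≫ p ≫ q) ≫ 𝟙 _ := by simp [h]
      refine (e _ _ _ rfl ?_).trans ?_
      · exact CategoryTheory.Functor.map_id _ _
      · exact congrArg (· ≫ 𝟙 _) (Category.id_comp _)

/-- The pseudo cone `π` given by evaluation. -/
def evalCone : PseudoCone (B := PsAlg.{w, u} T) (psAlg F) F where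
  app := evalHom F
  naturality f := λ_ (evalHom F _) ≪≫ (evalIso F f).symm
  naturality_naturality {i j f g} α := by
    obtain rfl := LocallyDiscrete.eq_of_hom α
    obtain rfl : α = 𝟙 f := Subsingleton.elim _ _
    rw [PrelaxFunctor.map₂_id, PrelaxFunctor.map₂_id]
    simp
  naturality_id j := by
    apply hom_ext₂
    ext η
    have e {C : Type u} [Category.{u} C] {a b : C} (p : a ≅ b) (q : a ⟶ b) (h : p.hom = q) :
      (𝟙 _ ≫ p.inv) ≫ q = 𝟙 _ ≫ 𝟙 _ ≫ 𝟙 _ := by simp [← h]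
    exact e (pointIso F (𝟙 j) η) _ (pointIso_id η j)
  naturality_comp {i j k} f g := by
    apply hom_ext₂
    ext η
    -- All coherence 2-cells of `evalCone` are inverses, so the equation for `τ(f ≫ g)` is inverted.
    have e {C : Type u} [Category.{u} C] {a b c d : C} (p : a ≅ d) (q : a ⟶ b) (r : b ≅ c)
        (s : c ≅ d) (h : p.hom = q ≫ r.hom ≫ s.hom) :
        (𝟙 _ ≫ p.inv) ≫ q = 𝟙 _ ≫ 𝟙 _ ≫ (𝟙 _ ≫ s.inv) ≫ 𝟙 _ ≫ r.inv ≫ 𝟙 _ := by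
      have hq : q = p.hom ≫ s.inv ≫ r.inv := by simp [h]
      simp [hq]
    have h := e (pointIso F (f ≫ g) η) _ ((F.map g).functor.mapIso (pointIso F f η))
      (pointIso F g η) (pointIso_comp η f g)
    refine h.trans ?_
    -- The component of the 2-cell at `f` is `𝟙 ≫ τ(f)⁻¹`, since it starts with a unitor.
    have hm : (F.map g).functor.map (pointIso F f η).inv =
      (F.map g).functor.map (𝟙 _ ≫ (pointIso F f η).inv) := by rw [Category.id_comp]
    simp only [Functor.mapIso_inv, hm]
    rfl

theorem evalCone_isEvaluation : IsEvaluation F (alg F) (evalCone F) where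
  functor_eq _ := rfl
  ρ_eq _ _ _ _ := ⟨rfl, rfl⟩
  τ_eq _ _ :=
    (Category.comp_id _).trans ((Category.comp_id _).symm.trans (Category.id_comp _).symm)

end PointCone

/-! ### The universal property -/

namespace PointCone

open PseudoAlgebra.Hom

variable {T : LawvereTheory.{w}} {J : Type u} [SmallCategory J]
  {F : LocallyDiscrete J ⥤ᵖ PsAlg.{w, u} T} {V : PsAlg.{w, u} T}

/-- The component at `v` of the 2-cell `τ^κ(f) : F f ∘ κ_i ⇒ κ_j`. -/
def coneIso (κ : PseudoCone V F) {i j : LocallyDiscrete J} (f : i ⟶ j) (v : V.carrier) :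
    (F.map f).functor.obj ((κ.app i).functor.obj v) ≅ (κ.app j).functor.obj v where
  hom := (κ.naturality f).inv.nat.app v
  inv := (κ.naturality f).hom.nat.app v
  hom_inv_id := congrArg (fun α => α.nat.app v) (κ.naturality f).inv_hom_id
  inv_hom_id := congrArg (fun α => α.nat.app v) (κ.naturality f).hom_inv_id

theorem coneIso_naturality (κ : PseudoCone V F) {i j : LocallyDiscrete J} (f : i ⟶ j)
    {v v' : V.carrier} (a : v ⟶ v') :
    (F.map f).functor.map ((κ.app i).functor.map a) ≫ (coneIso κ f v').hom =
      (coneIso κ f v).hom ≫ (κ.app j).functor.map a :=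
  (κ.naturality f).inv.nat.naturality a

theorem coneIso_id (κ : PseudoCone V F) (j : LocallyDiscrete J) (v : V.carrier) :
    (coneIso κ (𝟙 j) v).hom = (F.mapId j).hom.nat.app ((κ.app j).functor.obj v) := by
  have h := congrArg (fun α => α.nat.app v)
    (Pseudofunctor.StrongTrans.naturality_id_inv κ j)
  have e {C : Type u} [Category.{u} C] {a b c : C} (p : a ⟶ b) (q : b ⟶ c) (hbc : b = c)
    (hq : q = eqToHom hbc) : p ≫ 𝟙 _ ≫ 𝟙 _ ≫ q = p ≫ eqToHom hbc := by simp [hq]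
  refine h.trans ((e _ _ rfl ?_).trans (Category.comp_id _))
  exact CategoryTheory.Functor.map_id _ _

theorem coneIso_comp (κ : PseudoCone V F) {i j k : LocallyDiscrete J} (f : i ⟶ j) (g : j ⟶ k)
    (v : V.carrier) :
    (coneIso κ (f ≫ g) v).hom = (F.mapComp f g).hom.nat.app ((κ.app i).functor.obj v) ≫
      (F.map g).functor.map (coneIso κ f v).hom ≫ (coneIso κ g v).hom := by
  have h := congrArg (fun α => α.nat.app v)
    (Pseudofunctor.StrongTrans.naturality_comp_inv κ f g)
  have e {C : Type u} [Category.{u} C] {a b c d d' : C} (p : a ⟶ b) (q : b ⟶ c) (r : c ⟶ d)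
    (s : d ⟶ d') (hd : d = d') (hs : s = eqToHom hd) :
    p ≫ 𝟙 _ ≫ q ≫ 𝟙 _ ≫ r ≫ 𝟙 _ ≫ s = p ≫ q ≫ r ≫ eqToHom hd := by simp [hs]
  refine h.trans ((e _ _ _ _ rfl ?_).trans ?_)
  · exact CategoryTheory.Functor.map_id _ _
  · exact congrArg (_ ≫ _ ≫ ·) (Category.comp_id _)

/-- The compatibility of the 2-cell `τ^κ(f)` with `ρ`, read as: the components of the `ρ_w` of the
`κ_j` form a morphism of point cones. -/
theorem coneIso_op (κ : PseudoCone V F) {i j : LocallyDiscrete J} (f : i ⟶ j) {n : ℕ}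
    (w : T.Word n) (z : Fin n → V.carrier) :
    (F.map f).functor.map (((κ.app i).ρ w).hom.app z) ≫
        ((F.map f).transport w fun l => coneIso κ f (z l)).hom =
      (coneIso κ f ((V.alg.Φ w).obj z)).hom ≫ ((κ.app j).ρ w).hom.app z := by
  have h := (κ.naturality f).inv.comm w z
  rw [transport_hom, ← Category.assoc]
  refine h.trans (congrArg ((κ.naturality f).inv.nat.app _ ≫ ·) ?_)
  refine (congrArg (· ≫ ((κ.app j).ρ w).hom.app z) ?_).trans (Category.id_comp _)
  exact CategoryTheory.Functor.map_id _ _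

theorem modification_naturality {κ κ' : PseudoCone V F} (Θ : κ ⟶ κ') {i j : LocallyDiscrete J}
    (f : i ⟶ j) (v : V.carrier) :
    (F.map f).functor.map ((Θ.as.app i).nat.app v) ≫ (coneIso κ' f v).hom =
      (coneIso κ f v).hom ≫ (Θ.as.app j).nat.app v := by
  have h : (Θ.as.app j).nat.app v ≫ (coneIso κ' f v).inv =
      (coneIso κ f v).inv ≫ (F.map f).functor.map ((Θ.as.app i).nat.app v) :=
    congrArg (fun α => α.nat.app v) (Θ.as.naturality f)
  rw [← Iso.inv_comp_eq, ← Category.assoc, ← h, Category.assoc, Iso.inv_hom_id, Category.comp_id]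

/-- The point cone `κ(v)`, with objects `κ_j(v)` and isomorphisms `τ^κ(f)_v`. -/
def liftObj (κ : PseudoCone V F) (v : V.carrier) : PointCone F :=
  mk (fun j => (κ.app j).functor.obj v) (fun f => coneIso κ f v) (fun j => coneIso_id κ j v)
    (fun f g => coneIso_comp κ f g v)

/-- The morphism of algebras `v ↦ κ(v)` through which the pseudo cone `κ` factors strictly. -/
def lift (κ : PseudoCone V F) : V ⟶ psAlg F :=
  { functor :=
      { obj := liftObj κ
        map := fun a => homMk (fun j => (κ.app j).functor.map a) fun f => coneIso_naturality κ f a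
        map_id := fun v => hom_ext fun j => (κ.app j).functor.map_id v
        map_comp := fun a b => hom_ext fun j => (κ.app j).functor.map_comp a b }
    ρ := fun w => NatIso.ofComponents
      (fun z => isoMk (fun j => ((κ.app j).ρ w).app z) fun f => coneIso_op κ f w z)
      fun a => hom_ext fun j => ((κ.app j).ρ w).hom.naturality a
    ρ_gamma := fun w ws z => hom_ext fun j => (κ.app j).ρ_gamma w ws z
    ρ_one := fun z => hom_ext fun j => (κ.app j).ρ_one z
    ρ_subst := fun f w z => hom_ext fun j => (κ.app j).ρ_subst f w z }

/-- For the composite of `b` with evaluation, the isomorphisms `τ(f)_v` are those of the point cone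
`b v`. -/
theorem coneIso_compose (b : V ⟶ psAlg F) {i j : LocallyDiscrete J} (f : i ⟶ j)
    (v : V.carrier) : (coneIso (((evalCone F).compose V).obj b) f v).hom =
      (pointIso F f (b.functor.obj v)).hom := by
  have e {C : Type u} [Category.{u} C] {x y : C} (p : x ⟶ y) :
      (((𝟙 _ ≫ (p ≫ 𝟙 _)) ≫ 𝟙 _) ≫ (𝟙 _ ≫ 𝟙 _)) ≫ 𝟙 _ = p := by simp
  exact e (pointIso F f (b.functor.obj v)).hom

theorem compose_lift_app (κ : PseudoCone V F) (j : LocallyDiscrete J) :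
    (((evalCone F).compose V).obj (lift κ)).app j = κ.app j :=
  ext_of_functor_eq rfl fun {n} w z => by
    refine (congrArg (_ ≫ ·) (map_tuple_id ((F.obj j).alg.Φ w) _)).trans ?_
    exact (Category.comp_id _).trans ((Category.comp_id _).trans (Category.id_comp _).symm)

theorem compose_lift (κ : PseudoCone V F) : ((evalCone F).compose V).obj (lift κ) = κ := by
  refine strongTrans_ext (compose_lift_app κ) fun {i j} f => ?_
  apply hom_ext₂
  ext v
  -- The functors of both sides at `i` and `j` are definitionally equal, so the `eqToHom`s vanish.
  have h : (eqToHom (compose_lift_app κ i)).nat.app v = 𝟙 ((κ.app i).functor.obj v) := by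
    erw [eqToHom_nat, eqToHom_app]
    rfl
  have h' : (eqToHom (compose_lift_app κ j)).nat.app v = 𝟙 ((κ.app j).functor.obj v) := by
    erw [eqToHom_nat, eqToHom_app]
    rfl
  refine (congrArg ((coneIso (((evalCone F).compose V).obj (lift κ)) f v).hom ≫ ·) h').trans ?_
  refine Eq.trans ?_ (congrArg (fun a => (F.map f).functor.map a ≫ (coneIso κ f v).hom) h).symm
  refine (Category.comp_id _).trans ((coneIso_compose _ f v).trans ?_)
  refine (Category.id_comp _).symm.trans (congrArg (· ≫ (coneIso κ f v).hom) ?_)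
  exact (CategoryTheory.Functor.map_id _ _).symm

theorem liftObj_compose (b : V ⟶ psAlg F) (v : V.carrier) :
    liftObj (((evalCone F).compose V).obj b) v = b.functor.obj v :=
  ext (fun _ => rfl) fun f =>
    (coneIso_compose b f v).trans ((Category.comp_id _).symm.trans (Category.id_comp _).symm)

/-- The equality of object maps evaluates to `rfl` at every `j`, so its `eqToHom` evaluates to an
identity; hence the two functors also agree on morphisms. -/
theorem lift_compose_functor (b : V ⟶ psAlg F) :
    (lift (((evalCone F).compose V).obj b)).functor = b.functor :=
  CategoryTheory.Functor.ext (liftObj_compose b) fun v v' a => hom_ext fun j => by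
    rw [CategoryTheory.Functor.map_comp, CategoryTheory.Functor.map_comp]
    refine Eq.trans ?_ (congrArg₂ (fun p q => p ≫ (evalPoint F j).map (b.functor.map a) ≫ q)
      (eqToHom_map (evalPoint F j) (liftObj_compose b v))
      (eqToHom_map (evalPoint F j) (liftObj_compose b v').symm)).symm
    exact (Category.comp_id _).symm.trans (Category.id_comp _).symm

theorem lift_compose (b : V ⟶ psAlg F) : lift (((evalCone F).compose V).obj b) = b :=
  ext_of_functor_eq (lift_compose_functor b) fun {n} w z => hom_ext fun j => by
    have h (v : V.carrier) : (evalPoint F j).map ((eqToHom (lift_compose_functor b)).app v) =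
        𝟙 ((evalPoint F j).obj (b.functor.obj v)) := by
      rw [eqToHom_app]
      exact eqToHom_map (evalPoint F j) (liftObj_compose b v)
    rw [CategoryTheory.Functor.map_comp, CategoryTheory.Functor.map_comp]
    refine Eq.trans ?_ (congrArg (· ≫ (evalPoint F j).map ((b.ρ w).hom.app z)) (h _)).symm
    have h' := congrArg ((F.obj j).alg.Φ w).map (funext fun l => h (z l))
    refine (congrArg (_ ≫ ·) (h'.trans (map_tuple_id _ _))).trans ?_
    refine (Category.comp_id _).trans (Eq.trans ?_ (Category.id_comp _).symm)
    exact Category.comp_id _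

instance : ((evalCone F).compose V).Faithful where
  map_injective {b b'} θ θ' h := by
    apply hom_ext₂
    ext1
    funext v
    apply hom_ext
    intro j
    exact congrArg (fun α => (α.as.app j).nat.app v) h

instance : ((evalCone F).compose V).Full where
  map_surjective {b b'} Θ := by
    refine ⟨{ nat := { app := fun v => homMk (fun j => (Θ.as.app j).nat.app v) fun f => ?_
                       naturality := fun v v' a => hom_ext fun j => ?_ }
              comm := fun w z => hom_ext fun j => ?_ }, ?_⟩
    · have h := modification_naturality Θ f v
      rw [coneIso_compose, coneIso_compose] at h
      exact h
    · exact (Θ.as.app j).nat.naturality a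
    · have h := (Θ.as.app j).comm w z
      rw [CategoryTheory.Functor.map_comp, CategoryTheory.Functor.map_comp]
      refine Eq.trans ?_ (h.trans ?_)
      · exact congrArg (· ≫ _) (Category.comp_id _).symm
      · exact congrArg (_ ≫ ·) (Category.comp_id _)
    · rfl

variable (F) in
theorem evalCone_isPseudoLimit : IsPseudoLimit (evalCone F) := fun _ =>
  isIsoOfCategories_of_fullyFaithful _ lift lift_compose compose_lift

end PointCone

theorem mainTheorem2 (T : LawvereTheory.{w}) (J : Type u) [SmallCategory J]
    (F : LocallyDiscrete J ⥤ᵖ PsAlg.{w, u} T) :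
    ∃ (A : PseudoAlgebra T (PointCone F))
      (π : PseudoCone (B := PsAlg.{w, u} T) ⟨PointCone F, A⟩ F),
      IsComponentwise F A ∧ IsEvaluation F A π ∧ IsPseudoLimit π :=
  ⟨PointCone.alg F, PointCone.evalCone F, PointCone.alg_isComponentwise F,
    PointCone.evalCone_isEvaluation F, PointCone.evalCone_isPseudoLimit F⟩
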